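/- Let $\mathfrak m=\bigoplus_{p<0}\mathfrak g_p$ be a fundamental graded Lie algebra (FGLA) over $\mathbb R$, that is, a finite dimensional graded Lie algebra generated by $\mathfrak g_{-1}\neq\{0\}$, and assume $\mathfrak g_{-2}\ne\{0\}$. Let $g$ be a nondegenerate symmetric bilinear form (of any signature) on $\mathfrak g_{-1}$ and $[g]=\{\eta g:\eta>0\}$ its conformal class; the pair $(\mathfrak m,[g])$ is called a conformal pseudo-subriemannian FGLA. Let $\mathfrak g_0$ be the Lie algebra of all derivations $D$ of $\mathfrak m$ with $D(\mathfrak g_p)\subset\mathfrak g_p$ for all $p<0$ and such that there is $\eta_D\in\mathbb R$ with $$g(Dx,y)+g(x,Dy)=\eta_D\,g(x,y)\qquad(x,y\in\mathfrak g_{-1}).$$ The prolongation of $(\mathfrak m,[g])$ is the graded Lie algebra $\mathfrak g=\bigoplus_{p\in\mathbb Z}\mathfrak g_p$ whose components of degree $p\le 0$ are those of $\mathfrak m\oplus\mathfrak g_0$ (with $[D,x]=Dx$ for $D\in\mathfrak g_0$, $x\in\mathfrak m$) and whose components of degree $k\geq1$ are defined inductively by $$\mathfrak g_k=\Big\{u\in\bigoplus_{p<0}\operatorname{Hom}(\mathfrak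 g_p,\mathfrak g_{p+k}) : u([x,y])=[u(x),y]+[x,u(y)]\ \text{ for all } x,y\in\mathfrak m\Big\},$$ where $[u,x]=-[x,u]=u(x)$ for $u\in\mathfrak g_k$, $x\in\mathfrak m$; it is the maximum among the graded Lie algebras $\mathfrak l=\bigoplus_{p\in\mathbb Z}\mathfrak l_p$ such that (i) $\mathfrak l_p=\mathfrak g_p$ for $p\le0$ and (ii) $\mathfrak l$ is transitive: if $p\ge0$, $X\in\mathfrak l_p$ and $[X,\mathfrak l_{-1}]=\{0\}$, then $X=0$. **Lemma.** The prolongation $\mathfrak g$ of any conformal pseudo-subriemannian FGLA $(\mathfrak m,[g])$ is finite dimensional. Likewise, every graded Lie algebra $\mathfrak l$ satisfying (i) and (ii) is finite dimensional. -/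

import Mathlib

open scoped DirectSum

universe u v

namespace SubRiem

section Conformal

variable {V : Type u} [AddCommGroup V] [Module ℝ V]

/-- `co(V, g)`: the endomorphisms `A` of `V` with `A · g = η g` for some real `η`, where
`(A · g)(x, y) = g(A x, y) + g(x, A y)`. -/
def co (g : LinearMap.BilinForm ℝ V) : Submodule ℝ (Module.End ℝ V) where
  carrier := {A | ∃ η : ℝ, ∀ x y, g (A x) y + g x (A y) = η * g x y}
  zero_mem' := ⟨0, by simp⟩
  add_mem' := by
    rintro A B ⟨a, ha⟩ ⟨b, hb⟩
    refine ⟨a + b, fun x y => ?_⟩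
    simp only [LinearMap.add_apply, map_add]
    linear_combination ha x y + hb x y
  smul_mem' := by
    rintro c A ⟨a, ha⟩
    refine ⟨c * a, fun x y => ?_⟩
    simp only [LinearMap.smul_apply, map_smul, smul_eq_mul]
    linear_combination c * ha x y

/-- `co(V, g)` is closed under commutators, so it is a Lie algebra. -/
theorem commutator_mem_co {g : LinearMap.BilinForm ℝ V} {A B : Module.End ℝ V}
    (hA : A ∈ co g) (hB : B ∈ co g) : A * B - B * A ∈ co g := by
  obtain ⟨a, ha⟩ := hA
  obtain ⟨b, hb⟩ := hB
  refine ⟨0, fun x y => ?_⟩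
  simp only [LinearMap.sub_apply, Module.End.mul_apply, map_sub]
  linear_combination ha (B x) y - hb (A x) y + ha x (B y) - hb x (A y) + a * hb x y - b * ha x y

/-- The conformal class `[g]` of a bilinear form: its positive multiples. -/
def conformalClass (g : LinearMap.BilinForm ℝ V) : Set (LinearMap.BilinForm ℝ V) :=
  {h | ∃ η : ℝ, 0 < η ∧ h = η • g}

/-- `co(V, g)` depends only on the conformal class of `g`. -/
theorem co_eq_of_mem_conformalClass {g h : LinearMap.BilinForm ℝ V}
    (hh : h ∈ conformalClass g) : co h = co g := by
  obtain ⟨c, hc, rfl⟩ := hh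
  ext A
  refine exists_congr fun η => forall_congr' fun x => forall_congr' fun y => ?_
  simp only [LinearMap.smul_apply, smul_eq_mul]
  constructor
  · intro H
    exact mul_left_cancel₀ hc.ne' (by linear_combination H)
  · intro H
    linear_combination c * H

end Conformal

section FGLA

variable {m : Type u} [LieRing m] [LieAlgebra ℝ m] (𝒢 : ℤ → Submodule ℝ m)

/-- A fundamental graded Lie algebra `m = ⨁_{p < 0} 𝒢 p` over `ℝ`. -/
structure IsFGLA [GradedLieAlgebra 𝒢] : Prop where
  finite : Module.Finite ℝ m
  eq_bot_of_nonneg : ∀ p : ℤ, 0 ≤ p → 𝒢 p = ⊥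
  ne_bot : 𝒢 (-1) ≠ ⊥
  generated : LieSubalgebra.lieSpan ℝ m (𝒢 (-1) : Set m) = ⊤

/-- The pair `(m, [g])` is a conformal pseudo-subriemannian FGLA. -/
structure IsConformalPseudoSubriemannian [GradedLieAlgebra 𝒢]
    (g : LinearMap.BilinForm ℝ (𝒢 (-1))) : Prop where
  isFGLA : IsFGLA 𝒢
  ne_bot_two : 𝒢 (-2) ≠ ⊥
  symm : g.IsSymm
  nondegenerate : g.Nondegenerate

variable {𝒢}

/-- The Lie algebra `𝔤₀` of `(m, [g])`: the derivations of `m` that preserve the grading and whose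
restriction to `𝒢 (-1)` belongs to `co(𝒢 (-1), g)`. -/
def g0 (g : LinearMap.BilinForm ℝ (𝒢 (-1))) : LieSubalgebra ℝ (LieDerivation ℝ m m) where
  carrier := {D | (∀ p : ℤ, p < 0 → ∀ x ∈ 𝒢 p, D x ∈ 𝒢 p) ∧
    ∃ A ∈ co g, ∀ x : 𝒢 (-1), ((A x : 𝒢 (-1)) : m) = D (x : m)}
  zero_mem' := ⟨by simp, 0, (co g).zero_mem, by simp⟩
  add_mem' := by
    rintro D E ⟨hD, A, hA, hAD⟩ ⟨hE, B, hB, hBE⟩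
    exact ⟨fun p hp x hx => add_mem (hD p hp x hx) (hE p hp x hx), A + B,
      (co g).add_mem hA hB, fun x => by simp [hAD, hBE]⟩
  smul_mem' := by
    rintro c D ⟨hD, A, hA, hAD⟩
    exact ⟨fun p hp x hx => (𝒢 p).smul_mem c (hD p hp x hx), c • A,
      (co g).smul_mem c hA, fun x => by simp [hAD]⟩
  lie_mem' := by
    rintro D E ⟨hD, A, hA, hAD⟩ ⟨hE, B, hB, hBE⟩
    refine ⟨fun p hp x hx => ?_, A * B - B * A, commutator_mem_co hA hB, fun x => ?_⟩
    · rw [LieDerivation.lie_apply]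
      exact sub_mem (hD p hp _ (hE p hp x hx)) (hE p hp _ (hD p hp x hx))
    · simp [LieDerivation.lie_apply, hAD, hBE]

end FGLA

section Prolongation

variable {m : Type u} [LieRing m] [LieAlgebra ℝ m]

/-- A real vector space `V` with subspaces `deg p` (`p ∈ ℤ`) and a bilinear bracket
`act : V × m → V`, `(v, x) ↦ [v, x]`. It is only used to carry the truncations
`⨁_{p ≤ k} 𝔤_p` of the prolongation through the recursion below. -/
structure Stage (m : Type u) [LieRing m] [LieAlgebra ℝ m] where
  V : Type u
  [addCommGroup : AddCommGroup V]
  [module : Module ℝ V]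
  deg : ℤ → Submodule ℝ V
  act : V →ₗ[ℝ] m →ₗ[ℝ] V

attribute [instance] Stage.addCommGroup Stage.module

variable (𝒢 : ℤ → Submodule ℝ m) (h : LieSubalgebra ℝ (LieDerivation ℝ m m))

/-- Given the truncation `S = ⨁_{p < k} 𝔤_p`, with `k > 0`, the degree `k` component of the
prolongation: the linear maps `u : m → S` of degree `k` (that is, elements of
`⨁_{p < 0} Hom(𝔤_p, 𝔤_{p + k})`) such that `u([x, y]) = [u(x), y] + [x, u(y)]`,
where `[x, v]` for `v ∈ S` means `-[v, x]`. -/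
def Stage.component (S : Stage m) (k : ℤ) : Submodule ℝ (m →ₗ[ℝ] S.V) where
  carrier := {u | (∀ p : ℤ, p < 0 → ∀ x ∈ 𝒢 p, u x ∈ S.deg (p + k)) ∧
    ∀ x y : m, u ⁅x, y⁆ = S.act (u x) y - S.act (u y) x}
  zero_mem' := ⟨by simp, by simp⟩
  add_mem' := by
    rintro u w ⟨hu, hu'⟩ ⟨hw, hw'⟩
    refine ⟨fun p hp x hx => add_mem (hu p hp x hx) (hw p hp x hx), fun x y => ?_⟩
    simp only [LinearMap.add_apply, map_add, hu', hw']
    abel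
  smul_mem' := by
    rintro c u ⟨hu, hu'⟩
    refine ⟨fun p hp x hx => Submodule.smul_mem _ c (hu p hp x hx), fun x y => ?_⟩
    simp only [LinearMap.smul_apply, map_smul, hu', smul_sub]

/-- The truncation `⨁_{p ≤ 0} 𝔤_p = m ⊕ 𝔤₀` with `𝔤₀ = h`, where `[D, y] = D y` for
`D ∈ 𝔤₀` and `y ∈ m`. -/
def stageZero : Stage m where
  V := m × h
  deg p := (𝒢 p).prod (if p = 0 then ⊤ else ⊥)
  act := LinearMap.mk₂ ℝ (fun v y => (⁅v.1, y⁆ + (v.2 : LieDerivation ℝ m m) y, 0))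
    (by intro a b y; ext <;> simp; abel)
    (by intro c a y; ext <;> simp)
    (by intro a y z; ext <;> simp; abel)
    (by intro c a y; ext <;> simp)

/-- Adjoining the degree `k` component to the truncation `S = ⨁_{p < k} 𝔤_p`, where
`[u, y] = u(y)` for `u ∈ 𝔤_k` and `y ∈ m`. -/
def Stage.next (S : Stage m) (k : ℤ) : Stage m where
  V := S.V × S.component 𝒢 k
  deg p := (S.deg p).prod (if p = k then ⊤ else ⊥)
  act := LinearMap.mk₂ ℝ (fun v y => (S.act v.1 y + (v.2 : m →ₗ[ℝ] S.V) y, 0))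
    (by intro a b y; ext <;> simp; abel)
    (by intro c a y; ext <;> simp)
    (by intro a y z; ext <;> simp; abel)
    (by intro c a y; ext <;> simp)

/-- The truncation `⨁_{p ≤ k} 𝔤_p` of the prolongation of `(m, h)`. -/
def stage : ℕ → Stage m
  | 0 => stageZero 𝒢 h
  | k + 1 => (stage k).next 𝒢 ((k : ℤ) + 1)

/-- The component `𝔤_{k+1}` (`k ≥ 0`) of the prolongation of `(m, h)`. -/
abbrev positivePart (k : ℕ) : Submodule ℝ (m →ₗ[ℝ] (stage 𝒢 h k).V) :=
  (stage 𝒢 h k).component 𝒢 ((k : ℤ) + 1)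

/-- The underlying vector space `m ⊕ 𝔤₀ ⊕ ⨁_{k ≥ 1} 𝔤_k` of the (Tanaka) prolongation of
`(m, 𝔤₀)`, with `𝔤₀ = h`. -/
abbrev Prolongation : Type u := m × h × ⨁ k : ℕ, positivePart 𝒢 h k

end Prolongation

/-- A graded Lie algebra `L = ⨁_p ℒ p` is transitive if, for `X ∈ ℒ p` with `p ≥ 0`,
`[X, ℒ (-1)] = 0` implies `X = 0`. -/
def IsTransitive {L : Type v} [LieRing L] [LieAlgebra ℝ L] (ℒ : ℤ → Submodule ℝ L) : Prop :=
  ∀ p : ℤ, 0 ≤ p → ∀ X ∈ ℒ p, (∀ Y ∈ ℒ (-1), ⁅X, Y⁆ = 0) → X = 0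

/-- An identification of the components of degree `≤ 0` of a graded Lie algebra `L = ⨁_p ℒ p`
with those of `m ⊕ h`: the negative part of `L` is `m` (through `neg`), the degree `0` part of `L`
is `h` (through `zero`), and `[D, x] = D x` for `D ∈ h`, `x ∈ m`. -/
structure NonposIdentification {m : Type u} [LieRing m] [LieAlgebra ℝ m]
    (𝒢 : ℤ → Submodule ℝ m) (h : LieSubalgebra ℝ (LieDerivation ℝ m m))
    {L : Type v} [LieRing L] [LieAlgebra ℝ L] (ℒ : ℤ → Submodule ℝ L) where
  neg : m →ₗ⁅ℝ⁆ L
  neg_injective : Function.Injective neg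
  map_neg : ∀ p : ℤ, p < 0 → (𝒢 p).map (neg : m →ₗ[ℝ] L) = ℒ p
  zero : h →ₗ⁅ℝ⁆ L
  zero_injective : Function.Injective zero
  range_zero : LinearMap.range (zero : h →ₗ[ℝ] L) = ℒ 0
  lie_zero_neg : ∀ (D : h) (x : m), ⁅zero D, neg x⁆ = neg ((D : LieDerivation ℝ m m) x)

end SubRiem

/-! Let `W` be the prolongation, or any algebra as in (i) and (ii), seen as a graded `m`-module.
Elements of `m` lower degrees, and the degrees of `W` are bounded below, so `m` acts locally
nilpotently on `W`. The proof treats the vectors killed by `[m, m]` first, then enlarges the space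
they span until it is `W`.

On vectors killed by `[m, m]` the action of `m` is commutative. A homogeneous one `w` of degree 2
gives a symmetric trilinear map `[x, [y, [z, w]]]` with values in `𝒢 (-1)`, that is, an element of
the second prolongation of `co(V, g)`. That prolongation vanishes in dimension at least three. In
dimension two the derivations involved also kill the nonzero bracket `𝒢 (-1) × 𝒢 (-1) → 𝒢 (-2)`, so
they are trace-free and again vanish (`second_prolongation_eq_zero`). By transitivity such vectors
live in degrees at most 1, and each component is finite dimensional.

For the enlargement, let `z ∈ [m, m]` act on a submodule so as to commute with all of `m`. There `z`
is a sum of commutators of `K[z]`-linear maps. If `z` is locally nilpotent with finite-dimensional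
kernel but not nilpotent, then a free module of positive finite rank over the dual numbers `K[z]/z²`
appears inside `W`. The trace of `z` on it is the rank times `z`, which is nonzero in characteristic
zero, whereas commutators have trace zero. So `z` is nilpotent and the submodule is finite
dimensional. Applying this to spanning elements of the successive terms of the lower central series
goes from the annihilator of `[m, m]` up to `W`. -/

/-! ### Commutators and the trace over the dual numbers -/

section Commutators

variable {K V : Type*} [Field K] [AddCommGroup V] [Module K V]

/-- Traces over the dual numbers: if `z` maps onto its finite-dimensional kernel within a stable
subspace `R` and is a combination of commutators of endomorphisms commuting with `z`, then it is
injective on `R`. -/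
theorem disjoint_ker_of_mem_span_commutators [CharZero K] {z : Module.End K V}
    {R : Submodule K V} (hR : ∀ f : Module.End K V, Commute f z → ∀ v ∈ R, f v ∈ R)
    (hsurj : LinearMap.ker z ⊓ R ≤ R.map z) [FiniteDimensional K (LinearMap.ker z)]
    (hz : z ∈ Submodule.span K
      {c | ∃ f h : Module.End K V, Commute f z ∧ Commute h z ∧ c = f * h - h * f}) :
    LinearMap.ker z ⊓ R = ⊥ := by
  set U := LinearMap.ker z ⊓ R with hU
  have : FiniteDimensional K U := Submodule.finiteDimensional_of_le (inf_le_left : U ≤ _)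
  have hzU : ∀ u : U, z (u : V) = 0 := fun u => u.2.1
  obtain ⟨p, hp⟩ : ∃ p : V →ₗ[K] U, p ∘ₗ U.subtype = LinearMap.id :=
    LinearMap.exists_leftInverse_of_injective _ U.ker_subtype
  have hp' : ∀ u : U, p u = u := fun u => LinearMap.congr_fun hp u
  have hpv : ∀ v ∈ U, ((p v : U) : V) = v := fun v hv => by rw [hp' ⟨v, hv⟩]
  obtain ⟨s, hs⟩ : ∃ s : U →ₗ[K] R, (z ∘ₗ R.subtype) ∘ₗ s = U.subtype := by
    have hle : LinearMap.range U.subtype ≤ LinearMap.range (z ∘ₗ R.subtype) := by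
      rw [Submodule.range_subtype, LinearMap.range_comp, Submodule.range_subtype]
      exact hsurj
    exact Module.projective_lifting_property
      ((z ∘ₗ R.subtype).rangeRestrict) (U.subtype.codRestrict _ fun u => hle ⟨u, rfl⟩)
      (LinearMap.surjective_rangeRestrict _) |>.imp fun s hs => by
        ext u
        exact congrArg Subtype.val (LinearMap.congr_fun hs u)
  have hs' : ∀ u : U, z (s u : V) = u := fun u => LinearMap.congr_fun hs u
  -- Correcting the lift `s` by an element of `U ⊆ ker z` keeps `z ∘ t` the inclusion and places `t`
  -- in the kernel of `p`. Then `U ⊕ t(U)` is free over the dual numbers, with basis any basis of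
  -- `t(U)`.
  let t : U →ₗ[K] V := R.subtype ∘ₗ s - U.subtype ∘ₗ p ∘ₗ R.subtype ∘ₗ s
  have ht : ∀ u, t u = (s u : V) - (p (s u : V) : V) := fun u => rfl
  have htR : ∀ u, t u ∈ R := fun u => R.sub_mem (s u).2 (p (s u : V)).2.2
  have hzt : ∀ u, z (t u) = u := fun u => by rw [ht, map_sub, hs', hzU, sub_zero]
  have hpt : ∀ u, p (t u) = 0 := fun u => by rw [ht, map_sub, hp', sub_self]
  -- A map `f` commuting with `z` acts on `U ⊕ t(U)` as `ρ f + ε φ f` with `ε = z`. Hence the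
  -- Leibniz rule `key`, and the trace of `φ f` is the `ε`-part of the trace over the dual numbers.
  let φ : Module.End K V →ₗ[K] Module.End K U :=
    { toFun := fun f => p ∘ₗ f ∘ₗ t
      map_add' := fun f h => by ext; simp
      map_smul' := fun c f => by ext; simp }
  let ρ : Module.End K V → Module.End K U := fun f => p ∘ₗ f ∘ₗ U.subtype
  have hfU : ∀ f : Module.End K V, Commute f z → ∀ u ∈ U, f u ∈ U := fun f hf u hu => by
    refine ⟨?_, hR f hf u hu.2⟩
    have h := LinearMap.congr_fun hf.eq u
    simp only [Module.End.mul_apply] at h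
    change z (f u) = 0
    rw [← h, LinearMap.mem_ker.1 hu.1, map_zero]
  have key : ∀ f h : Module.End K V, Commute f z → Commute h z →
      φ (f * h) = φ f * ρ h + ρ f * φ h := by
    intro f h hf hh
    ext u
    have hc := LinearMap.congr_fun hh.eq (t u)
    simp only [Module.End.mul_apply] at hc
    have h1 : h (t u) - t (ρ h u) ∈ U := by
      refine ⟨?_, R.sub_mem (hR h hh _ (htR u)) (htR _)⟩
      change z (h (t u) - t (ρ h u)) = 0
      rw [map_sub, hzt, ← hc, hzt]
      change h (u : V) - (p (h (u : V)) : V) = 0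
      rw [hpv _ (hfU h hh _ u.2), sub_self]
    have h2 : h (t u) = t (ρ h u) + (φ h u : V) := by
      rw [← sub_eq_iff_eq_add', ← hpv _ h1, map_sub, hpt, sub_zero]
      rfl
    change ((p (f (h (t u))) : U) : V) = _
    rw [h2, map_add, map_add]
    rfl
  have htr : ∀ c ∈ Submodule.span K
      {c | ∃ f h : Module.End K V, Commute f z ∧ Commute h z ∧ c = f * h - h * f},
      LinearMap.trace K U (φ c) = 0 := by
    intro c hc
    induction hc using Submodule.span_induction with
    | mem c hc =>
      obtain ⟨f, h, hf, hh, rfl⟩ := hc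
      rw [map_sub, key f h hf hh, key h f hh hf, map_sub, map_add, map_add,
        LinearMap.trace_mul_comm K (φ f), LinearMap.trace_mul_comm K (ρ f)]
      abel
    | zero => simp
    | add a b _ _ ha hb => rw [map_add, map_add, ha, hb, add_zero]
    | smul a b _ hb => rw [map_smul, map_smul, hb, smul_zero]
  have hφz : φ z = 1 := by
    ext u
    change ((p (z (t u)) : U) : V) = _
    rw [hzt, hp']
    rfl
  -- `φ z` is the identity of `U`, so its vanishing trace is the dimension of `U` as an element of
  -- `K`.
  have := htr z hz
  rw [hφz, LinearMap.trace_one, Nat.cast_eq_zero] at this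
  exact Submodule.finrank_eq_zero.1 this

theorem finiteDimensional_ker_pow {z : Module.End K V}
    [FiniteDimensional K (LinearMap.ker z)] (n : ℕ) :
    (LinearMap.ker (z ^ n)).FG := by
  induction n with
  | zero => simpa [Module.End.one_eq_id] using Submodule.fg_bot
  | succ n ih =>
    refine Submodule.fg_of_fg_map_of_fg_inf_ker z ?_ ?_
    · have : FiniteDimensional K (LinearMap.ker (z ^ n)) := Module.Finite.iff_fg.2 ih
      refine Module.Finite.iff_fg.1 (Submodule.finiteDimensional_of_le
        (S₂ := LinearMap.ker (z ^ n)) ?_)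
      rintro _ ⟨v, hv, rfl⟩
      rw [SetLike.mem_coe, LinearMap.mem_ker, pow_succ] at hv
      exact hv
    · exact Module.Finite.iff_fg.1 (Submodule.finiteDimensional_of_le
        (S₂ := LinearMap.ker z) inf_le_right)

/-- A locally nilpotent endomorphism with finite-dimensional kernel that is a combination of
commutators of endomorphisms commuting with it lives on a finite-dimensional space. -/
theorem finiteDimensional_of_mem_span_commutators [CharZero K] {z : Module.End K V}
    (hnil : ∀ v, ∃ n : ℕ, (z ^ n) v = 0) (hker : FiniteDimensional K (LinearMap.ker z))
    (hz : z ∈ Submodule.span K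
      {c | ∃ f h : Module.End K V, Commute f z ∧ Commute h z ∧ c = f * h - h * f}) :
    FiniteDimensional K V := by
  let R : ℕ → Submodule K V := fun n => LinearMap.range (z ^ n)
  have hRanti : Antitone R := antitone_nat_of_succ_le fun n => by
    rintro _ ⟨v, rfl⟩
    exact ⟨z v, by rw [pow_succ]; rfl⟩
  -- The ranges of the powers of `z` need not stabilize a priori, but their intersections with the
  -- finite-dimensional kernel do.
  obtain ⟨N, hN⟩ := IsArtinian.monotone_stabilizes
    (⟨fun n => OrderDual.toDual ((R n).comap (LinearMap.ker z).subtype),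
      fun a b hab => Submodule.comap_mono (hRanti hab)⟩ :
      ℕ →o (Submodule K (LinearMap.ker z))ᵒᵈ)
  have hdisj : LinearMap.ker z ⊓ R N = ⊥ := by
    refine disjoint_ker_of_mem_span_commutators ?_ ?_ hz
    · rintro f hf _ ⟨v, rfl⟩
      exact ⟨f v, (LinearMap.congr_fun (hf.pow_right N).eq v).symm⟩
    · rintro u ⟨hu, hu'⟩
      have h1 : (⟨u, hu⟩ : LinearMap.ker z) ∈ (R N).comap (LinearMap.ker z).subtype := hu'
      have h2 : (R N).comap (LinearMap.ker z).subtype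
        = (R (N + 1)).comap (LinearMap.ker z).subtype := hN (N + 1) N.le_succ
      rw [h2] at h1
      obtain ⟨v, hv⟩ := h1
      refine ⟨(z ^ N) v, ⟨v, rfl⟩, ?_⟩
      rw [pow_succ'] at hv
      exact hv
  -- Injectivity of `z` on the range of `z ^ N` makes the exponent of nilpotency uniform.
  have hzN : ∀ n v, (z ^ (N + n)) v = 0 → (z ^ N) v = 0 := by
    intro n
    induction n with
    | zero => exact fun v hv => hv
    | succ n ih =>
      intro v hv
      refine ih v ?_
      have : (z ^ (N + n)) v ∈ LinearMap.ker z ⊓ R N := by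
        refine ⟨?_, hRanti (Nat.le_add_right N n) ⟨v, rfl⟩⟩
        rw [← add_assoc, pow_succ'] at hv
        exact hv
      rwa [hdisj] at this
  have htop : LinearMap.ker (z ^ N) = ⊤ := by
    rw [eq_top_iff]
    intro v _
    obtain ⟨n, hn⟩ := hnil v
    refine hzN n v ?_
    rw [pow_add, Module.End.mul_apply, hn, map_zero]
  exact ⟨htop ▸ finiteDimensional_ker_pow N⟩

end Commutators

/-! ### Locally nilpotent modules over a nilpotent Lie algebra -/

section LieModule

variable {K : Type*} [Field K] [CharZero K] {m : Type*} [LieRing m] [LieAlgebra K m]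

/-- All of `m` acts by operators commuting with `z`, and `z` is a sum of brackets, so the trace
criterion applies to its action. -/
theorem finiteDimensional_of_central_action {W : Type*} [AddCommGroup W] [Module K W]
    [LieRingModule m W] [LieModule K m W] {z : m}
    (hz : z ∈ LieModule.lowerCentralSeries K m m 1)
    (hcomm : ∀ (x : m) (w : W), ⁅⁅x, z⁆, w⁆ = 0)
    (hnil : ∀ w : W, ∃ n : ℕ, (LieModule.toEnd K m W z ^ n) w = 0)
    (hker : FiniteDimensional K (LinearMap.ker (LieModule.toEnd K m W z))) :
    FiniteDimensional K W := by
  have hc : ∀ x : m, Commute (LieModule.toEnd K m W x) (LieModule.toEnd K m W z) := fun x => by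
    ext w
    have := hcomm x w
    rwa [lie_lie, sub_eq_zero] at this
  refine finiteDimensional_of_mem_span_commutators hnil hker ?_
  rw [LieModule.lowerCentralSeries_succ, ← LieSubmodule.mem_toSubmodule,
    LieSubmodule.lieIdeal_oper_eq_linear_span'] at hz
  have := Submodule.mem_map_of_mem (f := (LieModule.toEnd K m W : m →ₗ[K] Module.End K W)) hz
  rw [Submodule.map_span] at this
  refine Submodule.span_mono ?_ this
  rintro _ ⟨_, ⟨x, -, y, -, rfl⟩, rfl⟩
  exact ⟨_, _, hc x, hc y, LinearMap.ext fun w => lie_lie x y w⟩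

variable (K) (W : Type*) [AddCommGroup W] [Module K W] [LieRingModule m W] [LieModule K m W]


/-- The subspace of vectors killed by a set of elements of `m`. -/
def annihilatedBy (S : Set m) : Submodule K W where
  carrier := {w | ∀ z ∈ S, ⁅z, w⁆ = 0}
  zero_mem' := by simp
  add_mem' := fun {a b} ha hb z hz => by rw [lie_add, ha z hz, hb z hz, add_zero]
  smul_mem' := fun c w hw z hz => by rw [lie_smul, hw z hz, smul_zero]

variable {K W}

/-- Stability of `S` under brackets makes its annihilator a submodule. There `z` commutes with `m`,
because each `[x, z]` lies in `S`, and its kernel is the annihilator of `insert z S`. -/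
theorem finiteDimensional_annihilatedBy_of_insert {S : Set m}
    (hS : ∀ x : m, ∀ z ∈ S, ⁅x, z⁆ ∈ S) {z : m}
    (hz : z ∈ LieModule.lowerCentralSeries K m m 1) (hzS : ∀ x : m, ⁅x, z⁆ ∈ S)
    (hnil : ∀ w : W, ∃ n : ℕ, (LieModule.toEnd K m W z ^ n) w = 0)
    (h : FiniteDimensional K (annihilatedBy K W (insert z S))) :
    FiniteDimensional K (annihilatedBy K W S) := by
  let N : LieSubmodule K m W :=
    { annihilatedBy K W S with
      lie_mem := fun {x w} hw z hz => by
        rw [leibniz_lie, hw z hz, lie_zero, add_zero, ← lie_skew, neg_lie, hw _ (hS x z hz),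
          neg_zero] }
  change FiniteDimensional K N
  have hpow : ∀ (n : ℕ) (w : N), (((LieModule.toEnd K m N z ^ n) w : N) : W)
      = (LieModule.toEnd K m W z ^ n) (w : W) := by
    intro n
    induction n with
    | zero => intro w; rfl
    | succ n ih =>
      intro w
      rw [pow_succ, pow_succ, Module.End.mul_apply, Module.End.mul_apply, ih]
      rfl
  refine finiteDimensional_of_central_action hz (fun x w => Subtype.ext (w.2 _ (hzS x))) ?_ ?_
  · intro w
    obtain ⟨n, hn⟩ := hnil w
    exact ⟨n, Subtype.ext ((hpow n w).trans hn)⟩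
  · let f : LinearMap.ker (LieModule.toEnd K m N z) →ₗ[K] annihilatedBy K W (insert z S) :=
      LinearMap.codRestrict _ ((N : Submodule K W).subtype ∘ₗ Submodule.subtype _) (by
        rintro ⟨w, hw⟩ y (rfl | hy)
        · exact congrArg Subtype.val hw
        · exact w.2 y hy)
    refine FiniteDimensional.of_injective f fun a b hab => ?_
    exact Subtype.ext (Subtype.ext (congrArg (fun w : annihilatedBy K W (insert z S) => (w : W)) hab))

/-- A module over a nilpotent Lie algebra `m` on which the elements of `m` act locally nilpotently
is finite dimensional as soon as the subspace killed by `[m, m]` is. -/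
theorem finiteDimensional_of_annihilatedBy_derived [FiniteDimensional K m]
    [LieModule.IsNilpotent m m]
    (hnil : ∀ (z : m) (w : W), ∃ n : ℕ, (LieModule.toEnd K m W z ^ n) w = 0)
    (h : FiniteDimensional K (annihilatedBy K W
      (LieModule.lowerCentralSeries K m m 1 : Set m))) :
    FiniteDimensional K W := by
  let C : ℕ → LieIdeal K m := fun k => LieModule.lowerCentralSeries K m m k
  have hC : ∀ k, ∀ x : m, ∀ z ∈ C k, ⁅x, z⁆ ∈ C (k + 1) := fun k x z hz => by
    change _ ∈ LieModule.lowerCentralSeries K m m (k + 1)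
    rw [LieModule.lowerCentralSeries_succ]
    exact LieSubmodule.lie_mem_lie (LieSubmodule.mem_top x) hz
  have hCanti : Antitone C := LieModule.antitone_lowerCentralSeries K m m
  have step : ∀ k, 1 ≤ k → FiniteDimensional K (annihilatedBy K W (C k : Set m)) →
      FiniteDimensional K (annihilatedBy K W (C (k + 1) : Set m)) := by
    intro k hk hfin
    classical
    obtain ⟨s, hs⟩ : (C k : Submodule K m).FG := (IsNoetherian.noetherian (C k : Submodule K m))
    -- The elements of a spanning set of `C k` are removed one at a time. The intermediate sets stay
    -- stable under brackets since `[m, C k] ⊆ C (k + 1)`.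
    have hins : ∀ t : Finset m, (t : Set m) ⊆ C k →
        FiniteDimensional K (annihilatedBy K W ((t : Set m) ∪ C (k + 1))) →
        FiniteDimensional K (annihilatedBy K W (C (k + 1) : Set m)) := by
      intro t
      induction t using Finset.induction_on with
      | empty => exact fun _ hfd => by rwa [Finset.coe_empty, Set.empty_union] at hfd
      | insert z t _ ih =>
        intro hsub hfd
        rw [Finset.coe_insert, Set.insert_subset_iff] at hsub
        refine ih hsub.2 (finiteDimensional_annihilatedBy_of_insert ?_ (hCanti hk hsub.1) ?_
          (hnil z) ?_)
        · rintro x y (hy | hy)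
          · exact Or.inr (hC k x y (hsub.2 hy))
          · exact Or.inr (hCanti (Nat.le_succ _) (hC (k + 1) x y hy))
        · exact fun x => Or.inr (hC k x z hsub.1)
        · rwa [Finset.coe_insert, Set.insert_union] at hfd
    refine hins s (fun x hx => ?_) (Submodule.finiteDimensional_of_le
      (S₂ := annihilatedBy K W (C k : Set m)) fun w hw => ?_)
    · have := Submodule.subset_span (R := K) hx
      rwa [hs] at this
    · intro z hz
      have hz' : z ∈ Submodule.span K (s : Set m) := hs ▸ hz
      clear hz
      induction hz' using Submodule.span_induction with
      | mem z hz => exact hw z (Or.inl hz)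
      | zero => simp
      | add a b ha hb iha ihb =>
        rw [add_lie, iha,
          ihb, add_zero]
      | smul c a ha iha =>
        rw [smul_lie, iha, smul_zero]
  have all : ∀ k, FiniteDimensional K (annihilatedBy K W (C (k + 1) : Set m)) := by
    intro k
    induction k with
    | zero => exact h
    | succ k ih => exact step (k + 1) (by omega) ih
  obtain ⟨k, hk⟩ := LieModule.IsNilpotent.nilpotent K m m
  have hbot : C (k + 1) = ⊥ := eq_bot_iff.2 (hk ▸ hCanti k.le_succ)
  have htop : annihilatedBy K W (C (k + 1) : Set m) = ⊤ := by
    rw [eq_top_iff, hbot]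
    rintro w - z hz
    rw [(LieSubmodule.mem_bot z).1 hz, zero_lie]
  have := all k
  rw [htop] at this
  exact Module.Finite.equiv Submodule.topEquiv

end LieModule

namespace SubRiem

/-! ### The second prolongation of the conformal algebra -/

section SecondProlongation

variable {V U ι : Type*} [AddCommGroup V] [Module ℝ V] [AddCommGroup U] [Module ℝ U]

/-- If `η ∧ g = 0` (Kulkarni-Nomizu product) with `g` diagonal and nondegenerate in dimension at
least three, then `η = 0`. -/
theorem eq_zero_of_kulkarniNomizu_eq_zero {g η : ι → ι → ℝ} (hg : ∀ i j, i ≠ j → g i j = 0)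
    (hg' : ∀ i, g i i ≠ 0)
    (h : ∀ i j k l, η i k * g j l - η i l * g j k = η j k * g i l - η j l * g i k)
    (hcard : ∀ i j : ι, ∃ k, k ≠ i ∧ k ≠ j) (i j : ι) : η i j = 0 := by
  by_cases hij : i = j
  · subst hij
    obtain ⟨k, hk, -⟩ := hcard i i
    obtain ⟨l, hl, hlk⟩ := hcard i k
    have diag : ∀ a b, a ≠ b → η a a * g b b + η b b * g a a = 0 := fun a b hab => by
      have := h b a a b
      rw [hg a b hab, hg b a hab.symm] at this
      linarith
    have h1 := diag i k hk.symm
    have h2 := diag i l hl.symm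
    have h3 := diag k l hlk.symm
    have h4 : η i i * (g k k * g l l) = 0 := by
      linear_combination (1 / 2) * (g l l * h1 + g k k * h2 - g i i * h3)
    exact (mul_eq_zero.1 h4).resolve_right (mul_ne_zero (hg' k) (hg' l))
  · obtain ⟨l, hli, hlj⟩ := hcard i j
    have := h l i j l
    rw [hg i l hli.symm, hg i j hij, hg l j hlj] at this
    have h4 : η i j * g l l = 0 := by linarith
    exact (mul_eq_zero.1 h4).resolve_right (hg' l)

/-- The second prolongation of `co(V, g)` vanishes in dimension at least three; in dimension two
so does that of the subalgebra of the elements annihilating a nonzero alternating form `β`. -/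
theorem second_prolongation_eq_zero {g : LinearMap.BilinForm ℝ V} (hs : g.IsSymm)
    (hn : g.Nondegenerate) (e : Module.Basis ι ℝ V) (ho : g.IsOrthoᵢ e) {β : V →ₗ[ℝ] V →ₗ[ℝ] U}
    (hβ : β.IsAlt) (hβ0 : ∃ a b, β (e a) (e b) ≠ 0) {F : ι → ι → ι → V} {η : ι → ι → ℝ}
    (h12 : ∀ i j k, F i j k = F j i k) (h23 : ∀ i j k, F i j k = F i k j)
    (hη : ∀ i j k l, g (F i j k) (e l) + g (e k) (F i j l) = η i j * g (e k) (e l))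
    (hFβ : ∀ i j k l, β (F i j k) (e l) + β (e k) (F i j l) = 0) (i j k : ι) : F i j k = 0 := by
  have hoff : ∀ i j, i ≠ j → g (e i) (e j) = 0 := fun i j hij => ho hij
  have hdiag : ∀ i, g (e i) (e i) ≠ 0 := fun i =>
    ho.not_isOrtho_basis_self_of_separatingLeft hn.1 i
  have hη' : ∀ i j k l, g (F i j k) (e l) + g (F i j l) (e k) = η i j * g (e k) (e l) :=
    fun i j k l => by
      rw [← hη, ← hs.eq (e k)]
  have hsymm : ∀ i j, g (e i) (e j) = g (e j) (e i) := fun i j => hs.eq (e i) (e j)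
  -- As for the Christoffel symbols, total symmetry of `F` recovers it from `η` by a signed sum of
  -- three permuted relations.
  have hchr : ∀ i j k l, 2 * g (F i j k) (e l) =
      η i j * g (e k) (e l) + η i k * g (e j) (e l) - η i l * g (e j) (e k) := by
    intro i j k l
    have h1 := hη' i j k l
    have h2 := hη' i k j l
    have h3 := hη' i l j k
    rw [h23 i k j, h23 i k l] at h2
    rw [h23 i l j] at h3
    linarith
  have hηsymm : ∀ i j, η i j = η j i := fun i j => by
    have h1 := hη' i j i i
    rw [h12 i j i, hη' j i i i] at h1
    exact (mul_right_cancel₀ (hdiag i) h1).symm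
  have hη0 : ∀ i j, η i j = 0 := by
    obtain ⟨a, b, hab⟩ := hβ0
    have hne : a ≠ b := by
      rintro rfl
      exact hab (hβ _)
    by_cases hc : ∃ c, c ≠ a ∧ c ≠ b
    · obtain ⟨c, hca, hcb⟩ := hc
      refine eq_zero_of_kulkarniNomizu_eq_zero (g := fun i j => g (e i) (e j)) hoff hdiag ?_ ?_
      -- Symmetry of `F` in its first two indices, inserted in `hchr`, is the vanishing of the
      -- Kulkarni-Nomizu product.
      · intro i j k l
        have h1 := hchr i j k l
        have h2 := hchr j i k l
        rw [h12 j i k, hηsymm j i] at h2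
        linarith
      · intro i j
        by_cases ha : a ≠ i ∧ a ≠ j
        · exact ⟨a, ha⟩
        by_cases hb : b ≠ i ∧ b ≠ j
        · exact ⟨b, hb⟩
        · refine ⟨c, ?_, ?_⟩ <;> grind
    -- In dimension two, conformality makes both diagonal entries `x` and `y'` equal to `η i j / 2`,
    -- and invariance of `β` makes the trace `x + y'` zero.
    · have hspan : ∀ v, ∃ x y : ℝ, x • e a + y • e b = v := fun v => by
        rw [← Submodule.mem_span_pair]
        have hr : Set.range e ⊆ {e a, e b} := by
          rintro _ ⟨c, rfl⟩
          by_cases h : c = a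
          · exact Or.inl (h ▸ rfl)
          · by_cases h' : c = b
            · exact Or.inr (h' ▸ rfl)
            · exact absurd ⟨c, h, h'⟩ hc
        exact Submodule.span_mono hr (e.span_eq ▸ Submodule.mem_top)
      intro i j
      obtain ⟨x, y, hxy⟩ := hspan (F i j a)
      obtain ⟨x', y', hxy'⟩ := hspan (F i j b)
      have h1 := hη' i j a a
      have h2 := hη' i j b b
      have h3 := hFβ i j a b
      rw [← hxy] at h1 h3
      rw [← hxy'] at h2 h3
      simp only [map_add, map_smul, LinearMap.add_apply, LinearMap.smul_apply, hβ (e a), hβ (e b),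
        hoff b a hne.symm, hoff a b hne, smul_zero, smul_eq_mul, mul_zero, add_zero,
        zero_add, ← add_smul] at h1 h2 h3
      have h3' := (smul_eq_zero.1 h3).resolve_right hab
      have h1' : (2 * x - η i j) * g (e a) (e a) = 0 := by linarith
      have h2' : (2 * y' - η i j) * g (e b) (e b) = 0 := by linarith
      have h1'' := (mul_eq_zero.1 h1').resolve_right (hdiag a)
      have h2'' := (mul_eq_zero.1 h2').resolve_right (hdiag b)
      linarith
  refine hn.1 _ fun v => ?_
  have : g (F i j k) = 0 := e.ext fun l => by
    have := hchr i j k l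
    simp only [hη0, zero_mul, add_zero, sub_zero] at this
    simpa using this
  rw [this, LinearMap.zero_apply]

end SecondProlongation

/-! ### Vectors killed by the derived algebra -/

section Graded

variable {m : Type u} [LieRing m] [LieAlgebra ℝ m] {𝒢 : ℤ → Submodule ℝ m} [GradedLieAlgebra 𝒢]

/-- Otherwise `𝒢 (-1)` is a subalgebra, hence all of `m` by generation, and nothing is left in
degree `-2`. -/
theorem exists_lie_ne_zero (h𝒢 : IsFGLA 𝒢) (h2 : 𝒢 (-2) ≠ ⊥) :
    ∃ x ∈ 𝒢 (-1), ∃ y ∈ 𝒢 (-1), ⁅x, y⁆ ≠ 0 := by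
  by_contra! H
  let A : LieSubalgebra ℝ m :=
    { 𝒢 (-1) with
      lie_mem' := fun {x y} hx hy => by
        rw [H x hx y hy]
        exact (𝒢 (-1)).zero_mem }
  have hA : ∀ x, x ∈ 𝒢 (-1) := fun x => by
    have : LieSubalgebra.lieSpan ℝ m (𝒢 (-1) : Set m) ≤ A :=
      LieSubalgebra.lieSpan_le.2 fun x hx => hx
    rw [h𝒢.generated] at this
    exact this (LieSubalgebra.mem_top x)
  refine h2 (eq_bot_iff.2 fun x hx => ?_)
  have h1 := DirectSum.decompose_of_mem_same 𝒢 hx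
  rwa [DirectSum.decompose_of_mem_ne 𝒢 (hA x) (by norm_num), eq_comm] at h1

theorem lie_mem_lowerCentralSeries_one (x y : m) :
    ⁅x, y⁆ ∈ LieModule.lowerCentralSeries ℝ m m 1 := by
  rw [LieModule.lowerCentralSeries_succ]
  exact LieSubmodule.lie_mem_lie (LieSubmodule.mem_top x) (LieSubmodule.mem_top y)

/-- A vector is killed by `[m, m]` as soon as it is killed by all brackets. -/
theorem mem_annihilatedBy_derived_iff {W : Type*} [AddCommGroup W] [Module ℝ W]
    [LieRingModule m W] [LieModule ℝ m W] {w : W} :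
    w ∈ annihilatedBy ℝ W (LieModule.lowerCentralSeries ℝ m m 1 : Set m) ↔
      ∀ x y : m, ⁅⁅x, y⁆, w⁆ = 0 := by
  refine ⟨fun h x y => h _ (lie_mem_lowerCentralSeries_one x y), fun h z hz => ?_⟩
  rw [SetLike.mem_coe, LieModule.lowerCentralSeries_succ, ← LieSubmodule.mem_toSubmodule,
    LieSubmodule.lieIdeal_oper_eq_linear_span'] at hz
  induction hz using Submodule.span_induction with
  | mem z hz =>
    obtain ⟨x, -, y, -, rfl⟩ := hz
    exact h x y
  | zero => exact zero_lie w
  | add a b _ _ ha hb => rw [add_lie, ha, hb, add_zero]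
  | smul c a _ ha => rw [smul_lie, ha, smul_zero]

variable {W : Type*} [AddCommGroup W] [Module ℝ W] [LieRingModule m W] [LieModule ℝ m W]
  {g : LinearMap.BilinForm ℝ (𝒢 (-1))}

/-- In a transitive graded `m`-module `W` (with projections `π p` onto the components) whose
component of degree zero acts through `𝔤₀`, the part killed by `[m, m]` has degree at most one. -/
theorem proj_eq_zero_of_mem_annihilatedBy (hg : IsConformalPseudoSubriemannian 𝒢 g)
    {π : ℤ → W →ₗ[ℝ] W} (hπ : ∀ p w, π p (π p w) = π p w)
    (hlie : ∀ q p, ∀ x ∈ 𝒢 q, ∀ w, π (q + p) ⁅x, w⁆ = ⁅x, π p w⁆)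
    (htrans : ∀ p, 0 ≤ p → ∀ w, π p w = w → (∀ x ∈ 𝒢 (-1), ⁅x, w⁆ = 0) → w = 0)
    {j : m →ₗ[ℝ] W} (hj : Function.Injective j)
    (hzero : ∀ w, π 0 w = w → ∃ D ∈ g0 g, ∀ x, ⁅x, w⁆ = j (D x))
    {w : W} (hw : w ∈ annihilatedBy ℝ W (LieModule.lowerCentralSeries ℝ m m 1 : Set m))
    {p : ℤ} (hp : 2 ≤ p) : π p w = 0 := by
  simp only [mem_annihilatedBy_derived_iff] at hw
  have hcomm : ∀ w : W, (∀ x y : m, ⁅⁅x, y⁆, w⁆ = 0) → ∀ x y : m, ⁅x, ⁅y, w⁆⁆ = ⁅y, ⁅x, w⁆⁆ :=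
    fun w hw x y => by rw [leibniz_lie, hw, zero_add]
  have hstab : ∀ w : W, (∀ x y : m, ⁅⁅x, y⁆, w⁆ = 0) → ∀ z x y : m, ⁅⁅x, y⁆, ⁅z, w⁆⁆ = 0 :=
    fun w hw z x y => by rw [hcomm w hw, hw, lie_zero]
  have hproj : ∀ p, ∀ x y : m, ⁅⁅x, y⁆, π p w⁆ = 0 := by
    intro p x y
    induction x using DirectSum.Decomposition.inductionOn 𝒢 with
    | zero => simp
    | add a b ha hb => rw [add_lie, add_lie, ha, hb, add_zero]
    | @homogeneous q x =>
      induction y using DirectSum.Decomposition.inductionOn 𝒢 with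
      | zero => simp
      | add a b ha hb => rw [lie_add, add_lie, ha, hb, add_zero]
      | @homogeneous r y =>
        rw [← hlie _ p _ (SetLike.GradedBracket.bracket_mem x.2 y.2), hw, map_zero]
  have hdeg : ∀ p w, π p w = w → ∀ x ∈ 𝒢 (-1), π (-1 + p) ⁅x, w⁆ = ⁅x, w⁆ :=
    fun p w hw x hx => by rw [hlie _ _ x hx, hw]
  have key : ∀ w, π 2 w = w → (∀ x y : m, ⁅⁅x, y⁆, w⁆ = 0) → w = 0 := by
    intro w hw2 hw
    have := hg.isFGLA.finite
    have : Invertible (2 : ℝ) := invertibleOfNonzero two_ne_zero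
    obtain ⟨e, he⟩ := LinearMap.BilinForm.exists_orthogonal_basis (K := ℝ) (B := g)
      (LinearMap.BilinForm.isSymm_iff.1 hg.symm)
    let X := fun i k => ⁅(e i : m), ⁅(e k : m), w⁆⁆
    have hX : ∀ i k, π 0 (X i k) = X i k := fun i k =>
      hdeg 1 _ (hdeg 2 w hw2 _ (e k).2) _ (e i).2
    choose D hD hDX using fun i k => hzero _ (hX i k)
    choose A hA hAD using fun i k => (hD i k).2
    choose η hη using hA
    have hXann : ∀ i k, ∀ x y : m, ⁅⁅x, y⁆, X i k⁆ = 0 := fun i k =>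
      hstab _ (hstab _ hw _) _
    -- This is the invariance of the bracket `β` that is needed in dimension two.
    have hDlie : ∀ i k (x y : m), D i k ⁅x, y⁆ = 0 := fun i k x y =>
      hj (by rw [← hDX, hXann, map_zero])
    let β : 𝒢 (-1) →ₗ[ℝ] 𝒢 (-1) →ₗ[ℝ] m :=
      LinearMap.mk₂ ℝ (fun x y => ⁅(x : m), (y : m)⁆) (by simp) (by simp) (by simp) (by simp)
    have hjA : ∀ i k l, j (A i k (e l) : m) = ⁅(e l : m), X i k⁆ := fun i k l => by
      rw [hAD, ← hDX]
    have hA0 : ∀ i k l, A i k (e l) = 0 := by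
      refine second_prolongation_eq_zero hg.symm hg.nondegenerate e he (β := β)
        (fun x => lie_self (x : m)) ?_ (F := fun i k l => A i k (e l)) (η := η) ?_ ?_ ?_ ?_
      · by_contra! H
        obtain ⟨x, hx, y, hy, hxy⟩ := exists_lie_ne_zero hg.isFGLA hg.ne_bot_two
        have : β = 0 := e.ext fun i => e.ext fun k => H i k
        exact hxy (LinearMap.congr_fun₂ this ⟨x, hx⟩ ⟨y, hy⟩)
      · intro i k l
        refine Subtype.ext (hj ?_)
        rw [hjA, hjA, show X i k = X k i from hcomm w hw _ _]
      · intro i k l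
        refine Subtype.ext (hj ?_)
        rw [hjA, hjA]
        change ⁅(e l : m), ⁅(e i : m), ⁅(e k : m), w⁆⁆⁆ = ⁅(e k : m), ⁅(e i : m), ⁅(e l : m), w⁆⁆⁆
        rw [hcomm _ (hstab w hw _), hcomm w hw (e l), hcomm _ (hstab w hw _)]
      · exact fun i k l n => hη i k _ _
      · intro i k l n
        change ⁅(A i k (e l) : m), (e n : m)⁆ + ⁅(e l : m), (A i k (e n) : m)⁆ = 0
        rw [hAD, hAD, add_comm, ← hDlie i k (e l) (e n), LieDerivation.apply_lie_eq_add]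
    have hbasis : ∀ w : W, (∀ i, ⁅(e i : m), w⁆ = 0) → ∀ x ∈ 𝒢 (-1), ⁅x, w⁆ = 0 := by
      intro w hw x hx
      let f : 𝒢 (-1) →ₗ[ℝ] W :=
        { toFun := fun x => ⁅(x : m), w⁆
          map_add' := fun a b => add_lie (a : m) b w
          map_smul' := fun c a => smul_lie c (a : m) w }
      have : f = 0 := e.ext hw
      exact LinearMap.congr_fun this ⟨x, hx⟩
    -- Transitivity in degrees 2, 1 and 0 reduces `w = 0` to the vanishing of all triple brackets
    -- with basis vectors.
    refine htrans 2 (by norm_num) w hw2 (hbasis w fun k => ?_)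
    refine htrans 1 (by norm_num) _ (hdeg 2 w hw2 _ (e k).2) (hbasis _ fun i => ?_)
    refine htrans 0 le_rfl _ (hX i k) (hbasis _ fun l => ?_)
    rw [← hjA, hA0, ZeroMemClass.coe_zero, map_zero]
  have all : ∀ n : ℕ, ∀ w, π (2 + n) w = w → (∀ x y : m, ⁅⁅x, y⁆, w⁆ = 0) → w = 0 := by
    intro n
    induction n with
    | zero => exact fun w hw => key w (by simpa using hw)
    | succ n ih =>
      intro w hwn hw
      refine htrans _ (by positivity) w hwn fun x hx => ih _ ?_ (hstab w hw x)
      have := hdeg _ w hwn x hx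
      rwa [show (-1 + (2 + ((n + 1 : ℕ) : ℤ))) = 2 + n by push_cast; ring] at this
  obtain ⟨n, rfl⟩ := Int.le.dest hp
  exact all n _ (hπ _ _) (hproj _)

end Graded

/-! ### Homogeneous projections and nilpotency of `m` -/

section Projection

variable {L : Type*} [LieRing L] [LieAlgebra ℝ L] (ℒ : ℤ → Submodule ℝ L) [GradedLieAlgebra ℒ]

/-- The projection of a graded Lie algebra onto its component of degree `p`. -/
def homogeneousProj (p : ℤ) : L →ₗ[ℝ] L :=
  (ℒ p).subtype ∘ₗ DirectSum.component ℝ ℤ (fun i => ℒ i) p ∘ₗ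
    (DirectSum.decomposeLinearEquiv ℒ).toLinearMap

theorem homogeneousProj_mem (p : ℤ) (x : L) : homogeneousProj ℒ p x ∈ ℒ p :=
  (DirectSum.decompose ℒ x p).2

variable {ℒ}

theorem homogeneousProj_of_mem {p : ℤ} {x : L} (hx : x ∈ ℒ p) : homogeneousProj ℒ p x = x :=
  DirectSum.decompose_of_mem_same ℒ hx

theorem homogeneousProj_of_mem_ne {p q : ℤ} {x : L} (hx : x ∈ ℒ p) (h : p ≠ q) :
    homogeneousProj ℒ q x = 0 :=
  DirectSum.decompose_of_mem_ne ℒ hx h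

theorem mem_of_homogeneousProj_mem {S : Submodule ℝ L} {x : L}
    (h : ∀ p, homogeneousProj ℒ p x ∈ S) : x ∈ S := by
  classical
  rw [← DirectSum.sum_support_decompose ℒ x]
  exact S.sum_mem fun p _ => h p

theorem homogeneousProj_lie {q p : ℤ} {x : L} (hx : x ∈ ℒ q) (y : L) :
    homogeneousProj ℒ (q + p) ⁅x, y⁆ = ⁅x, homogeneousProj ℒ p y⁆ := by
  induction y using DirectSum.Decomposition.inductionOn ℒ with
  | zero => simp
  | add a b ha hb => rw [lie_add, map_add, map_add, lie_add, ha, hb]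
  | @homogeneous r y =>
    have hxy := SetLike.GradedBracket.bracket_mem hx y.2
    by_cases h : r = p
    · subst h
      rw [homogeneousProj_of_mem hxy, homogeneousProj_of_mem y.2]
    · rw [homogeneousProj_of_mem_ne hxy (by omega), homogeneousProj_of_mem_ne y.2 h, lie_zero]

end Projection

theorem IsFGLA.exists_eq_bot {m : Type u} [LieRing m] [LieAlgebra ℝ m] {𝒢 : ℤ → Submodule ℝ m}
    [GradedLieAlgebra 𝒢] (h𝒢 : IsFGLA 𝒢) : ∃ N : ℕ, ∀ p : ℤ, p < -N → 𝒢 p = ⊥ := by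
  have := h𝒢.finite
  have hfin : {p | 𝒢 p ≠ ⊥}.Finite := WellFoundedGT.finite_ne_bot_of_iSupIndep
    (DirectSum.Decomposition.isInternal 𝒢).submodule_iSupIndep
  obtain ⟨N, hN⟩ := hfin.bddBelow
  refine ⟨N.natAbs, fun p hp => ?_⟩
  by_contra hne
  have := hN hne
  omega

/-- Bracketing lowers degrees by at least one, so the `k`-th term of the lower central series lies
in degrees below `-k`. -/
theorem isNilpotent_of_isFGLA {m : Type u} [LieRing m] [LieAlgebra ℝ m] {𝒢 : ℤ → Submodule ℝ m}
    [GradedLieAlgebra 𝒢] (h𝒢 : IsFGLA 𝒢) : LieModule.IsNilpotent m m := by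
  have hlow : ∀ k : ℕ, ∀ x ∈ LieModule.lowerCentralSeries ℝ m m k, ∀ p : ℤ, -k ≤ p →
      homogeneousProj 𝒢 p x = 0 := by
    intro k
    induction k with
    | zero =>
      intro x _ p hp
      have := homogeneousProj_mem 𝒢 p x
      rwa [h𝒢.eq_bot_of_nonneg p (by simpa using hp)] at this
    | succ k ih =>
      intro x hx p hp
      rw [LieModule.lowerCentralSeries_succ, ← LieSubmodule.mem_toSubmodule,
        LieSubmodule.lieIdeal_oper_eq_linear_span'] at hx
      induction hx using Submodule.span_induction with
      | mem x hx =>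
        obtain ⟨y, -, z, hz, rfl⟩ := hx
        induction y using DirectSum.Decomposition.inductionOn 𝒢 with
        | zero => simp
        | add a b ha hb => rw [add_lie, map_add, ha, hb, add_zero]
        | @homogeneous q y =>
          by_cases hq : 0 ≤ q
          · have : (y : m) = 0 :=
              (Submodule.mem_bot ℝ).1 ((h𝒢.eq_bot_of_nonneg q hq).le y.2)
            rw [this, zero_lie, map_zero]
          · have := homogeneousProj_lie (p := p - q) y.2 z
            rw [add_sub_cancel, ih z hz (p - q) (by push_cast at hp; omega), lie_zero] at this
            exact this
      | zero => exact map_zero _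
      | add a b _ _ ha hb => rw [map_add, ha, hb, add_zero]
      | smul c a _ ha => rw [map_smul, ha, smul_zero]
  obtain ⟨N, hN⟩ := h𝒢.exists_eq_bot
  refine (LieModule.isNilpotent_iff ℝ m m).2 ⟨N, eq_bot_iff.2 fun x hx => ?_⟩
  refine mem_of_homogeneousProj_mem (ℒ := 𝒢) (S := ⊥) fun p => ?_
  by_cases hp : -(N : ℤ) ≤ p
  · exact hlow _ x hx p hp
  · exact (hN p (by omega)).le (homogeneousProj_mem 𝒢 p x)

/-! ### Finiteness of transitive extensions of `m` -/

section Extension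

variable {m : Type u} [LieRing m] [LieAlgebra ℝ m] {𝒢 : ℤ → Submodule ℝ m} [GradedLieAlgebra 𝒢]
  {g : LinearMap.BilinForm ℝ (𝒢 (-1))}
  {W : Type*} [AddCommGroup W] [Module ℝ W] [LieRingModule m W]

/-- A graded `m`-module `W` containing `m`, with projections `π p` onto its components: its
components of negative degree are those of `m`, it is transitive, and its component of degree zero
acts on `m` through `𝔤₀`. -/
structure IsTransitiveExtension (g : LinearMap.BilinForm ℝ (𝒢 (-1))) (π : ℤ → W →ₗ[ℝ] W)
    (j : m →ₗ[ℝ] W) : Prop where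
  proj_proj : ∀ p w, π p (π p w) = π p w
  proj_lie : ∀ q p, ∀ x ∈ 𝒢 q, ∀ w, π (q + p) ⁅x, w⁆ = ⁅x, π p w⁆
  ext_zero : ∀ w, (∀ p, π p w = 0) → w = 0
  bddAbove : ∀ w, ∃ n : ℤ, ∀ p, n ≤ p → π p w = 0
  injective : Function.Injective j
  proj_neg : ∀ p, p < 0 → ∀ w, π p w ∈ (𝒢 p).map j
  transitive : ∀ p, 0 ≤ p → ∀ w, π p w = w → (∀ x ∈ 𝒢 (-1), ⁅x, w⁆ = 0) → w = 0
  acts_zero : ∀ w, π 0 w = w → ∃ D ∈ g0 g, ∀ x, ⁅x, w⁆ = j (D x)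

variable [LieModule ℝ m W]

namespace IsTransitiveExtension

variable {π : ℤ → W →ₗ[ℝ] W} {j : m →ₗ[ℝ] W} (hW : IsTransitiveExtension g π j)
include hW

omit [LieModule ℝ m W] in
theorem exists_proj_eq_zero (h𝒢 : IsFGLA 𝒢) : ∃ N : ℕ, ∀ p : ℤ, p < -N → ∀ w, π p w = 0 := by
  obtain ⟨N, hN⟩ := h𝒢.exists_eq_bot
  refine ⟨N, fun p hp w => ?_⟩
  have := hW.proj_neg p (by omega) w
  rwa [hN p hp, Submodule.map_bot] at this

omit [LieModule ℝ m W] in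
theorem proj_lie_eq_zero (h𝒢 : IsFGLA 𝒢) {n : ℤ} {w : W} (hw : ∀ p, n ≤ p → π p w = 0) (x : m) :
    ∀ p, n - 1 ≤ p → π p ⁅x, w⁆ = 0 := by
  intro p hp
  induction x using DirectSum.Decomposition.inductionOn 𝒢 with
  | zero => simp
  | add a b ha hb => rw [add_lie, map_add, ha, hb, add_zero]
  | @homogeneous q x =>
    by_cases hq : 0 ≤ q
    · rw [(Submodule.mem_bot ℝ).1 ((h𝒢.eq_bot_of_nonneg q hq).le x.2), zero_lie, map_zero]
    · have := hW.proj_lie q (p - q) x x.2 w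
      rwa [add_sub_cancel, hw _ (by omega), lie_zero] at this

/-- Each application of `z` lowers the top degree of a vector, and the degrees of `W` are bounded
below. -/
theorem locally_nilpotent (h𝒢 : IsFGLA 𝒢) (z : m) (w : W) :
    ∃ n : ℕ, (LieModule.toEnd ℝ m W z ^ n) w = 0 := by
  obtain ⟨N, hN⟩ := hW.exists_proj_eq_zero h𝒢
  obtain ⟨n, hn⟩ := hW.bddAbove w
  have hdown : ∀ k : ℕ, ∀ p, n - k ≤ p → π p ((LieModule.toEnd ℝ m W z ^ k) w) = 0 := by
    intro k
    induction k with
    | zero => simpa using hn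
    | succ k ih =>
      intro p hp
      rw [pow_succ']
      exact hW.proj_lie_eq_zero h𝒢 ih z p (by push_cast at hp; omega)
  refine ⟨(n + N).toNat, hW.ext_zero _ fun p => ?_⟩
  by_cases hp : p < -N
  · exact hN p hp _
  · exact hdown _ p (by omega)

/-- For `p ≥ 0`, transitivity embeds the component of degree `p` into the linear maps from `𝒢 (-1)`
to the component of degree `p - 1`. -/
theorem finiteDimensional_range_proj (h𝒢 : IsFGLA 𝒢) (p : ℤ) :
    FiniteDimensional ℝ (LinearMap.range (π p)) := by
  have := h𝒢.finite
  have hneg : ∀ p < 0, FiniteDimensional ℝ (LinearMap.range (π p)) := by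
    intro p hp
    refine Submodule.finiteDimensional_of_le (S₂ := (𝒢 p).map j) ?_
    rintro _ ⟨w, rfl⟩
    exact hW.proj_neg p hp w
  -- The shift by one starts the induction in degree `-1`, inside `m`.
  have hnn : ∀ n : ℕ, FiniteDimensional ℝ (LinearMap.range (π ((n : ℤ) - 1))) := by
    intro n
    induction n with
    | zero => exact hneg _ (by norm_num)
    | succ n ih =>
      have hfix : ∀ w ∈ LinearMap.range (π (((n + 1 : ℕ) : ℤ) - 1)),
          π (((n + 1 : ℕ) : ℤ) - 1) w = w := by
        rintro _ ⟨w, rfl⟩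
        exact hW.proj_proj _ w
      let f : LinearMap.range (π (((n + 1 : ℕ) : ℤ) - 1)) →ₗ[ℝ]
          𝒢 (-1) →ₗ[ℝ] LinearMap.range (π ((n : ℤ) - 1)) :=
        LinearMap.mk₂ ℝ (fun w x => ⟨⁅(x : m), (w : W)⁆, ⁅(x : m), (w : W)⁆, by
            have := hW.proj_lie _ (((n + 1 : ℕ) : ℤ) - 1) x x.2 w
            rw [hfix _ w.2] at this
            rwa [show (-1 : ℤ) + (((n + 1 : ℕ) : ℤ) - 1) = n - 1 by push_cast; ring] at this⟩)
          (fun a b x => Subtype.ext (lie_add _ _ _)) (fun c a x => Subtype.ext (lie_smul _ _ _))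
          (fun a x y => Subtype.ext (add_lie _ _ _)) (fun c a x => Subtype.ext (smul_lie _ _ _))
      refine FiniteDimensional.of_injective f ((injective_iff_map_eq_zero f).2 fun w hw => ?_)
      refine Subtype.ext (hW.transitive _ (by push_cast; omega) _ (hfix _ w.2) fun x hx => ?_)
      exact congrArg Subtype.val (LinearMap.congr_fun hw ⟨x, hx⟩)
  by_cases hp : p < 0
  · exact hneg p hp
  · have := hnn (p.toNat + 1)
    rwa [show ((p.toNat + 1 : ℕ) : ℤ) - 1 = p by push_cast; omega] at this

theorem finiteDimensional (hg : IsConformalPseudoSubriemannian 𝒢 g) : FiniteDimensional ℝ W := by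
  have h𝒢 := hg.isFGLA
  have := h𝒢.finite
  have := isNilpotent_of_isFGLA h𝒢
  refine finiteDimensional_of_annihilatedBy_derived (hW.locally_nilpotent h𝒢) ?_
  obtain ⟨N, hN⟩ := hW.exists_proj_eq_zero h𝒢
  have := hW.finiteDimensional_range_proj h𝒢
  -- The vectors killed by `[m, m]` are determined by their components in degrees `-N` to `1`.
  let f : annihilatedBy ℝ W (LieModule.lowerCentralSeries ℝ m m 1 : Set m) →ₗ[ℝ]
      (p : Finset.Icc (-N : ℤ) 1) → LinearMap.range (π p) :=
    LinearMap.pi fun p => (π p).rangeRestrict ∘ₗ Submodule.subtype _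
  refine FiniteDimensional.of_injective f ((injective_iff_map_eq_zero f).2 fun w hw => ?_)
  refine Subtype.ext (hW.ext_zero _ fun p => ?_)
  by_cases hp : p < -N
  · exact hN p hp _
  by_cases hp' : 2 ≤ p
  · exact proj_eq_zero_of_mem_annihilatedBy hg hW.proj_proj hW.proj_lie hW.transitive
      hW.injective hW.acts_zero w.2 hp'
  · exact congrArg Subtype.val (congrFun hw ⟨p, Finset.mem_Icc.2 ⟨by omega, by omega⟩⟩)

end IsTransitiveExtension

end Extension

/-! ### Transitive graded Lie algebras as extensions -/

/-- A transitive graded Lie algebra whose part of degree at most `0` is that of `(m, [g])` is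
finite dimensional. -/
theorem finiteDimensional_of_isTransitive {m : Type u} [LieRing m] [LieAlgebra ℝ m]
    {𝒢 : ℤ → Submodule ℝ m} [GradedLieAlgebra 𝒢] {g : LinearMap.BilinForm ℝ (𝒢 (-1))}
    (hg : IsConformalPseudoSubriemannian 𝒢 g) {L : Type v} [LieRing L] [LieAlgebra ℝ L]
    {ℒ : ℤ → Submodule ℝ L} [GradedLieAlgebra ℒ] (hℒ : IsTransitive ℒ)
    (e : NonposIdentification 𝒢 (g0 g) ℒ) : FiniteDimensional ℝ L := by
  let _ := LieRingModule.compLieHom L e.neg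
  have := LieModule.compLieHom (R := ℝ) L e.neg
  have hmem : ∀ q, ∀ x ∈ 𝒢 q, e.neg x ∈ ℒ q := fun q x hx => by
    by_cases hq : q < 0
    · exact (e.map_neg q hq).le ⟨x, hx, rfl⟩
    · rw [(Submodule.mem_bot ℝ).1 ((hg.isFGLA.eq_bot_of_nonneg q (by omega)).le hx), map_zero]
      exact zero_mem _
  have hfix : ∀ p w, homogeneousProj ℒ p w = w → w ∈ ℒ p := fun p w hw =>
    hw ▸ homogeneousProj_mem ℒ p w
  have hW : IsTransitiveExtension g (homogeneousProj ℒ) (e.neg : m →ₗ[ℝ] L) :=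
    { proj_proj := fun p w => homogeneousProj_of_mem (homogeneousProj_mem ℒ p w)
      proj_lie := fun q p x hx w => homogeneousProj_lie (hmem q x hx) w
      ext_zero := fun w hw => mem_of_homogeneousProj_mem (S := ⊥) hw
      bddAbove := fun w => by
        classical
        obtain ⟨n, hn⟩ := ((DirectSum.decompose ℒ w).support.finite_toSet).bddAbove
        refine ⟨n + 1, fun p hp => ?_⟩
        by_contra hne
        have : p ≤ n := hn (DFinsupp.mem_support_iff.2 fun h => hne (congrArg Subtype.val h))
        omega
      injective := e.neg_injective
      proj_neg := fun p hp w => (e.map_neg p hp).ge (homogeneousProj_mem ℒ p w)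
      transitive := fun p hp w hw h => hℒ p hp w (hfix p w hw) fun Y hY => by
        obtain ⟨x, hx, rfl⟩ := (e.map_neg (-1) (by norm_num)).ge hY
        rw [← lie_skew, neg_eq_zero]
        exact h x hx
      acts_zero := fun w hw => by
        obtain ⟨D, rfl⟩ := e.range_zero.ge (hfix 0 w hw)
        -- The sign comes from `[x, D] = -D x`.
        refine ⟨-D, neg_mem D.2, fun x => ?_⟩
        change ⁅e.neg x, e.zero D⁆ = e.neg (-(D : LieDerivation ℝ m m) x)
        rw [← lie_skew, e.lie_zero_neg, map_neg] }
  exact hW.finiteDimensional hg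

/-! ### The degree-by-degree prolongation as a graded `m`-module -/

section Prolongation

variable {m : Type u} [LieRing m] [LieAlgebra ℝ m] (𝒢 : ℤ → Submodule ℝ m)
  (h : LieSubalgebra ℝ (LieDerivation ℝ m m))

/-- The inclusion of the component of degree `k + 1` into the prolongation. -/
def ofPositive (k : ℕ) : positivePart 𝒢 h k →ₗ[ℝ] Prolongation 𝒢 h :=
  LinearMap.inr ℝ _ _ ∘ₗ LinearMap.inr ℝ _ _ ∘ₗ
    DirectSum.lof ℝ ℕ (fun k => positivePart 𝒢 h k) k

/-- The inclusion of the truncation `⨁_{p ≤ k} 𝔤_p` into the prolongation. -/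
def ofStage : (k : ℕ) → (stage 𝒢 h k).V →ₗ[ℝ] Prolongation 𝒢 h
  | 0 => (LinearMap.inl ℝ m (h × ⨁ k : ℕ, positivePart 𝒢 h k)).coprod
      (LinearMap.inr ℝ _ _ ∘ₗ LinearMap.inl ℝ _ _)
  | k + 1 => (ofStage k).coprod (ofPositive 𝒢 h k)

/-- The bracket `(w, x) ↦ [w, x]` of the prolongation with `m`. -/
def prolongationAct : Prolongation 𝒢 h →ₗ[ℝ] m →ₗ[ℝ] Prolongation 𝒢 h :=
  LinearMap.mk₂ ℝ (fun w x => (⁅w.1, x⁆ + (w.2.1 : LieDerivation ℝ m m) x, 0))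
    (by intro a b y; ext <;> simp; abel)
    (by intro c a y; ext <;> simp)
    (by intro a y z; ext <;> simp; abel)
    (by intro c a y; ext <;> simp)
  + (DirectSum.toModule ℝ ℕ _ fun k =>
      (LinearMap.llcomp ℝ m (stage 𝒢 h k).V (Prolongation 𝒢 h) (ofStage 𝒢 h k)) ∘ₗ
        (positivePart 𝒢 h k).subtype) ∘ₗ LinearMap.snd ℝ _ _ ∘ₗ LinearMap.snd ℝ _ _

theorem ofStage_zero (v : m × h) : ofStage 𝒢 h 0 v = (v.1, v.2, 0) := by
  change ((v.1, 0) : Prolongation 𝒢 h) + (0, v.2, 0) = _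
  simp

theorem ofStage_succ (k : ℕ) (v : (stage 𝒢 h k).V) (u : positivePart 𝒢 h k) :
    ofStage 𝒢 h (k + 1) (v, u) = ofStage 𝒢 h k v + ofPositive 𝒢 h k u := rfl

theorem prolongationAct_nonpos (y : m) (D : h) (x : m) :
    prolongationAct 𝒢 h (y, D, 0) x = (⁅y, x⁆ + (D : LieDerivation ℝ m m) x, 0) := by
  simp [prolongationAct]

theorem prolongationAct_ofPositive (k : ℕ) (u : positivePart 𝒢 h k) (x : m) :
    prolongationAct 𝒢 h (ofPositive 𝒢 h k u) x
      = ofStage 𝒢 h k ((u : m →ₗ[ℝ] (stage 𝒢 h k).V) x) := by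
  simp only [prolongationAct, ofPositive, LinearMap.add_apply, LinearMap.mk₂_apply]
  simp
  exact zero_add _

/-- Identities for the bracket with `m` can therefore be checked inside a single truncation. -/
theorem prolongationAct_ofStage (k : ℕ) (v : (stage 𝒢 h k).V) (x : m) :
    prolongationAct 𝒢 h (ofStage 𝒢 h k v) x = ofStage 𝒢 h k ((stage 𝒢 h k).act v x) := by
  induction k with
  | zero =>
    obtain ⟨y, D⟩ := v
    rw [ofStage_zero]
    rw [prolongationAct_nonpos]
    exact (ofStage_zero 𝒢 h (⁅y, x⁆ + (D : LieDerivation ℝ m m) x, 0)).symm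
  | succ k ih =>
    obtain ⟨v, u⟩ := v
    rw [ofStage_succ, map_add, LinearMap.add_apply, ih, prolongationAct_ofPositive, ← map_add]
    change _ = ofStage 𝒢 h (k + 1) ((stage 𝒢 h k).act v x + (u : m →ₗ[ℝ] (stage 𝒢 h k).V) x, 0)
    rw [ofStage_succ, map_zero, add_zero]

/-- At stage zero this is the Jacobi identity together with the Leibniz rule for `D`; on each
adjoined component it is the defining condition. -/
theorem stage_act_lie (k : ℕ) (v : (stage 𝒢 h k).V) (x y : m) :
    (stage 𝒢 h k).act v ⁅x, y⁆ = (stage 𝒢 h k).act ((stage 𝒢 h k).act v x) y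
      - (stage 𝒢 h k).act ((stage 𝒢 h k).act v y) x := by
  induction k with
  | zero =>
    obtain ⟨z, D⟩ := v
    have h1 : ∀ (v : m × h) (x : m), (stage 𝒢 h 0).act v x
      = ((⁅v.1, x⁆ + (v.2 : LieDerivation ℝ m m) x, 0) : m × h) := fun _ _ => rfl
    simp only [h1]
    refine Prod.ext ?_ (sub_zero 0).symm
    change ⁅z, ⁅x, y⁆⁆ + (D : LieDerivation ℝ m m) ⁅x, y⁆ =
      (⁅⁅z, x⁆ + (D : LieDerivation ℝ m m) x, y⁆ + (0 : LieDerivation ℝ m m) y)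
        - (⁅⁅z, y⁆ + (D : LieDerivation ℝ m m) y, x⁆ + (0 : LieDerivation ℝ m m) x)
    rw [LieDerivation.apply_lie_eq_sub, leibniz_lie, add_lie, add_lie,
      ← lie_skew ⁅z, y⁆ x, ← lie_skew ((D : LieDerivation ℝ m m) y) x,
      ← lie_skew ((D : LieDerivation ℝ m m) x) y]
    simp only [LieDerivation.coe_zero, Pi.zero_apply, add_zero]
    abel
  | succ k ih =>
    obtain ⟨v, u⟩ := v
    have h1 : ∀ (v : (stage 𝒢 h k).V) (u : positivePart 𝒢 h k) (x : m),
      (stage 𝒢 h (k + 1)).act (v, u) x = (((stage 𝒢 h k).act v x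
        + (u : m →ₗ[ℝ] (stage 𝒢 h k).V) x, 0) : (stage 𝒢 h k).V × positivePart 𝒢 h k) :=
      fun _ _ _ => rfl
    rw [h1, h1, h1, h1, h1]
    refine Prod.ext ?_ (sub_zero 0).symm
    change _ = ((stage 𝒢 h k).act ((stage 𝒢 h k).act v x + (u : m →ₗ[ℝ] (stage 𝒢 h k).V) x) y + 0)
      - ((stage 𝒢 h k).act ((stage 𝒢 h k).act v y + (u : m →ₗ[ℝ] (stage 𝒢 h k).V) y) x + 0)
    rw [ih, u.2.2, map_add, map_add, LinearMap.add_apply, LinearMap.add_apply,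
      add_zero, add_zero]
    exact sub_add_sub_comm _ _ _ _

variable {𝒢 h}

/-- The prolongation is spanned by the homogeneous elements of its truncations. -/
theorem prolongation_induction [DirectSum.Decomposition 𝒢] {motive : Prolongation 𝒢 h → Prop}
    (homogeneous : ∀ k p v, v ∈ (stage 𝒢 h k).deg p → motive (ofStage 𝒢 h k v))
    (add : ∀ a b, motive a → motive b → motive (a + b)) (w : Prolongation 𝒢 h) : motive w := by
  have h0 : motive 0 := by
    have := homogeneous 0 0 0 (zero_mem _)
    rwa [map_zero] at this
  obtain ⟨y, D, f⟩ := w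
  have hsum : ((y, D, f) : Prolongation 𝒢 h) = (y, 0, 0) + ((0, D, 0) + (0, 0, f)) := by simp
  rw [hsum]
  refine add _ _ ?_ (add _ _ ?_ ?_)
  · induction y using DirectSum.Decomposition.inductionOn 𝒢 with
    | zero => exact h0
    | add a b ha hb =>
      have : ((a + b, 0, 0) : Prolongation 𝒢 h) = (a, 0, 0) + (b, 0, 0) := by simp
      rw [this]
      exact add _ _ (ha (by simp)) (hb (by simp))
    | @homogeneous p y =>
      have := homogeneous 0 p ((y : m), (0 : h)) ⟨y.2, zero_mem _⟩
      rwa [ofStage_zero] at this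
  · have := homogeneous 0 0 ((0 : m), D) ⟨zero_mem _, by simp⟩
    rwa [ofStage_zero] at this
  · clear hsum
    induction f using DirectSum.induction_on with
    | zero => exact h0
    | add a b ha hb =>
      have : ((0, 0, a + b) : Prolongation 𝒢 h) = (0, 0, a) + (0, 0, b) := by simp
      rw [this]
      exact add _ _ ha hb
    | of k u =>
      have := homogeneous (k + 1) (k + 1) ((0 : (stage 𝒢 h k).V), u) ⟨zero_mem _, by simp⟩
      rwa [ofStage_succ, map_zero, zero_add] at this

theorem prolongationAct_lie [DirectSum.Decomposition 𝒢] (w : Prolongation 𝒢 h) (x y : m) :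
    prolongationAct 𝒢 h w ⁅x, y⁆ + prolongationAct 𝒢 h (prolongationAct 𝒢 h w y) x
      = prolongationAct 𝒢 h (prolongationAct 𝒢 h w x) y := by
  induction w using prolongation_induction with
  | homogeneous k p v =>
    simp only [prolongationAct_ofStage]
    rw [← map_add, stage_act_lie, sub_add_cancel]
  | add a b ha hb =>
    simp only [map_add, LinearMap.add_apply, ← ha, ← hb]
    exact add_add_add_comm _ _ _ _

variable (𝒢 h) in
/-- The action `x · w = [x, w] = [w, -x]` of `m` on the prolongation. -/
abbrev prolongationLieRingModule [DirectSum.Decomposition 𝒢] :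
    LieRingModule m (Prolongation 𝒢 h) where
  bracket x w := prolongationAct 𝒢 h w (-x)
  add_lie x y w := by
    rw [neg_add, map_add]
  lie_add x w w' := by
    change prolongationAct 𝒢 h (w + w') (-x) = _
    rw [map_add, LinearMap.add_apply]
  leibniz_lie x y w := by
    change prolongationAct 𝒢 h (prolongationAct 𝒢 h w (-y)) (-x)
      = prolongationAct 𝒢 h w (-⁅x, y⁆) + prolongationAct 𝒢 h (prolongationAct 𝒢 h w (-x)) (-y)
    rw [← prolongationAct_lie w (-y) (-x), neg_lie, lie_neg, neg_neg, lie_skew]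

theorem stage_act_mem_deg [SetLike.GradedBracket 𝒢] (hneg : ∀ p : ℤ, 0 ≤ p → 𝒢 p = ⊥)
    (hh : ∀ D ∈ h, ∀ p : ℤ, p < 0 → ∀ x ∈ 𝒢 p, D x ∈ 𝒢 p) {q : ℤ} {x : m} (hx : x ∈ 𝒢 q)
    (k : ℕ) {p : ℤ} {v : (stage 𝒢 h k).V} (hv : v ∈ (stage 𝒢 h k).deg p) :
    (stage 𝒢 h k).act v x ∈ (stage 𝒢 h k).deg (q + p) := by
  by_cases hq : 0 ≤ q
  · rw [(Submodule.mem_bot ℝ).1 ((hneg q hq).le hx), map_zero]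
    exact zero_mem _
  rw [not_le] at hq
  induction k with
  | zero =>
    obtain ⟨y, D⟩ := v
    refine ⟨add_mem ?_ ?_, zero_mem _⟩
    · rw [add_comm]
      exact SetLike.GradedBracket.bracket_mem hv.1 hx
    · have hD := hv.2
      by_cases hp : p = 0
      · rw [hp, add_zero]
        exact hh _ D.2 q hq x hx
      · simp only [hp, if_false] at hD
        rw [(Submodule.mem_bot ℝ).1 hD]
        exact zero_mem _
  | succ k ih =>
    obtain ⟨v, u⟩ := v
    refine ⟨add_mem (ih hv.1) ?_, zero_mem _⟩
    have hu := hv.2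
    by_cases hp : p = (k : ℤ) + 1
    · rw [hp]
      exact u.2.1 q hq x hx
    · simp only [hp, if_false] at hu
      rw [(Submodule.mem_bot ℝ).1 hu]
      exact zero_mem _

variable (𝒢 h) in
/-- The projection of the prolongation onto its component of degree `p`. -/
noncomputable def prolongationProj [GradedLieAlgebra 𝒢] (p : ℤ) :
    Prolongation 𝒢 h →ₗ[ℝ] Prolongation 𝒢 h :=
  (homogeneousProj 𝒢 p).prodMap ((if p = 0 then LinearMap.id else 0 : h →ₗ[ℝ] h).prodMap
    (DFinsupp.filterLinearMap ℝ (fun k => positivePart 𝒢 h k) fun k => p = (k : ℤ) + 1))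

theorem prolongationProj_apply [GradedLieAlgebra 𝒢] (p : ℤ) (y : m) (D : h)
    (f : ⨁ k : ℕ, positivePart 𝒢 h k) : prolongationProj 𝒢 h p (y, D, f)
      = (homogeneousProj 𝒢 p y, (if p = 0 then D else 0),
          DFinsupp.filter (fun k : ℕ => p = (k : ℤ) + 1) f) := by
  by_cases hp : p = 0 <;> simp [prolongationProj, hp] <;> rfl

theorem prolongationProj_ofPositive [GradedLieAlgebra 𝒢] (q : ℤ) (k : ℕ)
    (u : positivePart 𝒢 h k) : prolongationProj 𝒢 h q (ofPositive 𝒢 h k u)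
      = if q = (k : ℤ) + 1 then ofPositive 𝒢 h k u else 0 := by
  change prolongationProj 𝒢 h q (0, 0, DFinsupp.single k u) = _
  rw [prolongationProj_apply, DFinsupp.filter_single, map_zero]
  by_cases hq : q = (k : ℤ) + 1
  · rw [if_pos hq, if_pos hq, ite_self]
    rfl
  · rw [if_neg hq, if_neg hq, ite_self]
    rfl

theorem prolongationProj_ofStage [GradedLieAlgebra 𝒢] (q : ℤ) (k : ℕ) {p : ℤ}
    {v : (stage 𝒢 h k).V} (hv : v ∈ (stage 𝒢 h k).deg p) :
    prolongationProj 𝒢 h q (ofStage 𝒢 h k v) = if q = p then ofStage 𝒢 h k v else 0 := by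
  induction k with
  | zero =>
    obtain ⟨y, D⟩ := v
    have hy : y ∈ 𝒢 p := hv.1
    have hD : D ∈ (if p = 0 then ⊤ else ⊥ : Submodule ℝ h) := hv.2
    have hD' : p = 0 ∨ D = 0 := by
      by_cases hp : p = 0
      · exact Or.inl hp
      · rw [if_neg hp] at hD
        exact Or.inr hD
    rw [ofStage_zero, prolongationProj_apply]
    by_cases hq : q = p
    · subst hq
      rw [homogeneousProj_of_mem hy, if_pos rfl]
      refine Prod.ext rfl (Prod.ext ?_ (DFinsupp.filter_zero _))
      rcases hD' with rfl | rfl <;> simp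
    · rw [homogeneousProj_of_mem_ne hy (Ne.symm hq), if_neg hq]
      refine Prod.ext rfl (Prod.ext ?_ (DFinsupp.filter_zero _))
      rcases hD' with rfl | rfl
      · simp [hq]
      · simp
  | succ k ih =>
    obtain ⟨v, u⟩ := v
    have hu : u ∈ (if p = (k : ℤ) + 1 then ⊤ else ⊥ : Submodule ℝ (positivePart 𝒢 h k)) := hv.2
    rw [ofStage_succ, map_add, ih hv.1, prolongationProj_ofPositive]
    by_cases hp : p = (k : ℤ) + 1
    · by_cases hq : q = p
      · rw [if_pos hq, if_pos (hq.trans hp), if_pos hq]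
      · rw [if_neg hq, if_neg fun h => hq (h.trans hp.symm), if_neg hq, add_zero]
    · rw [if_neg hp] at hu
      rw [(Submodule.mem_bot ℝ).1 hu, map_zero, ite_self, add_zero, add_zero]

/-- The index `l` carries degree `l + 1`, while the truncation stops at degree `k`. -/
theorem ofStage_component_eq_zero (k l : ℕ) (hkl : k ≤ l) (v : (stage 𝒢 h k).V) :
    (ofStage 𝒢 h k v).2.2 l = 0 := by
  induction k with
  | zero =>
    obtain ⟨y, D⟩ := v
    rw [ofStage_zero]
    rfl
  | succ k ih =>
    obtain ⟨v, u⟩ := v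
    rw [ofStage_succ]
    change (ofStage 𝒢 h k v).2.2 l + (DFinsupp.single k u : Π₀ k, positivePart 𝒢 h k) l = 0
    rw [ih (by omega), DFinsupp.single_eq_of_ne (by omega), add_zero]

theorem ofStage_injective (k : ℕ) : Function.Injective (ofStage 𝒢 h k) := by
  refine (injective_iff_map_eq_zero _).2 fun v hv => ?_
  induction k with
  | zero =>
    obtain ⟨y, D⟩ := v
    rw [ofStage_zero] at hv
    exact Prod.ext (congrArg (fun w : Prolongation 𝒢 h => w.1) hv)
      (congrArg (fun w : Prolongation 𝒢 h => w.2.1) hv)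
  | succ k ih =>
    obtain ⟨v, u⟩ := v
    rw [ofStage_succ] at hv
    have hu : u = 0 := by
      have h1 : (ofStage 𝒢 h k v).2.2 k + (DFinsupp.single k u : Π₀ k, positivePart 𝒢 h k) k = 0 :=
        congrArg (fun w : Prolongation 𝒢 h => w.2.2 k) hv
      rwa [ofStage_component_eq_zero k k le_rfl, zero_add, DFinsupp.single_eq_same] at h1
    rw [hu, map_zero, add_zero] at hv
    exact Prod.ext (ih v hv) hu

end Prolongation

/-! ### Finiteness of the constructed prolongation -/

/-- The prolongation of `(m, [g])`, as constructed degree by degree, is finite dimensional. -/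
theorem finiteDimensional_prolongation {m : Type u} [LieRing m] [LieAlgebra ℝ m]
    {𝒢 : ℤ → Submodule ℝ m} [GradedLieAlgebra 𝒢] {g : LinearMap.BilinForm ℝ (𝒢 (-1))}
    (hg : IsConformalPseudoSubriemannian 𝒢 g) :
    FiniteDimensional ℝ (Prolongation 𝒢 (g0 g)) := by
  have h𝒢 := hg.isFGLA
  let _ := prolongationLieRingModule 𝒢 (g0 g)
  have hlie : ∀ (x : m) (w : Prolongation 𝒢 (g0 g)), ⁅x, w⁆ = prolongationAct 𝒢 (g0 g) w (-x) :=
    fun _ _ => rfl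
  have : LieModule ℝ m (Prolongation 𝒢 (g0 g)) :=
    { smul_lie := fun c x w => by rw [hlie, hlie, ← smul_neg, map_smul]
      lie_smul := fun c x w => by
        rw [hlie, hlie, map_smul, LinearMap.smul_apply] }
  have hnonpos : ∀ w, prolongationProj 𝒢 (g0 g) 0 w = w → ∃ D, w = (0, D, 0) := by
    rintro ⟨y, D, f⟩ hw
    rw [prolongationProj_apply] at hw
    refine ⟨D, Prod.ext ?_ (Prod.ext rfl ?_)⟩
    · have := congrArg Prod.fst hw
      rw [← this]
      exact (Submodule.mem_bot ℝ).1 ((h𝒢.eq_bot_of_nonneg 0 le_rfl).le (homogeneousProj_mem 𝒢 0 y))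
    · have := congrArg (fun w : Prolongation 𝒢 (g0 g) => w.2.2) hw
      refine DFinsupp.ext fun k => ?_
      change f k = 0
      change DFinsupp.filter (fun k : ℕ => (0 : ℤ) = (k : ℤ) + 1) f = f at this
      rw [← this, DFinsupp.filter_apply_neg]
      omega
  have hlie0 : ∀ (D : g0 g) (x : m), ⁅x, ((0, D, 0) : Prolongation 𝒢 (g0 g))⁆
      = LinearMap.inl ℝ m _ (-(D : LieDerivation ℝ m m) x) := fun D x => by
    rw [hlie, prolongationAct_nonpos, zero_lie, zero_add, map_neg]
    rfl
  have hgen : ∀ A : LieSubalgebra ℝ m, (∀ x ∈ 𝒢 (-1), x ∈ A) → ∀ x, x ∈ A := fun A hA x => by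
    have : LieSubalgebra.lieSpan ℝ m (𝒢 (-1) : Set m) ≤ A := LieSubalgebra.lieSpan_le.2 hA
    rw [h𝒢.generated] at this
    exact this (LieSubalgebra.mem_top x)
  have hW : IsTransitiveExtension (W := Prolongation 𝒢 (g0 g)) g
      (prolongationProj 𝒢 (g0 g)) (LinearMap.inl ℝ m _) :=
    { proj_proj := fun p w => by
        induction w using prolongation_induction with
        | homogeneous k q v hv =>
          rw [prolongationProj_ofStage p k hv]
          split_ifs with hpq
          · rw [prolongationProj_ofStage p k hv, if_pos hpq]
          · exact map_zero _
        | add a b ha hb => rw [map_add, map_add, ha, hb]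
      proj_lie := fun q p x hx w => by
        induction w using prolongation_induction with
        | homogeneous k r v hv =>
          have hact := stage_act_mem_deg (h := g0 g) h𝒢.eq_bot_of_nonneg (fun D hD => hD.1)
            (neg_mem hx) k hv
          rw [prolongationProj_ofStage p k hv, hlie, prolongationAct_ofStage,
            prolongationProj_ofStage _ k hact]
          by_cases hpr : p = r
          · rw [if_pos (by rw [hpr]), if_pos hpr, hlie, prolongationAct_ofStage]
          · rw [if_neg (by omega), if_neg hpr, hlie, map_zero]
            rfl
        | add a b ha hb =>
          simp only [hlie, map_add, LinearMap.add_apply] at ha hb ⊢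
          rw [ha, hb]
      ext_zero := by
        rintro ⟨y, D, f⟩ hw
        simp only [prolongationProj_apply] at hw
        refine Prod.ext ?_ (Prod.ext ?_ (DFinsupp.ext fun k => ?_))
        · exact mem_of_homogeneousProj_mem (ℒ := 𝒢) (S := ⊥) fun p => congrArg Prod.fst (hw p)
        · have := congrArg (fun w : Prolongation 𝒢 (g0 g) => w.2.1) (hw 0)
          simpa using this
        · have : DFinsupp.filter (fun l : ℕ => (k : ℤ) + 1 = (l : ℤ) + 1) f k = 0 :=
            congrArg (fun w : Prolongation 𝒢 (g0 g) => w.2.2 k) (hw ((k : ℤ) + 1))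
          rwa [DFinsupp.filter_apply, if_pos rfl] at this
      bddAbove := by
        rintro ⟨y, D, f⟩
        classical
        obtain ⟨n, hn⟩ := (DFinsupp.support f).finite_toSet.bddAbove
        refine ⟨(n : ℤ) + 2, fun p hp => ?_⟩
        rw [prolongationProj_apply, if_neg (by omega)]
        refine Prod.ext ?_ (Prod.ext rfl (DFinsupp.ext fun k => ?_))
        · exact (Submodule.mem_bot ℝ).1
            ((h𝒢.eq_bot_of_nonneg p (by omega)).le (homogeneousProj_mem 𝒢 p y))
        · rw [DFinsupp.filter_apply]
          split_ifs with hpk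
          · by_contra hne
            have : k ≤ n := hn (DFinsupp.mem_support_iff.2 hne)
            omega
          · rfl
      injective := LinearMap.inl_injective
      proj_neg := by
        rintro p hp ⟨y, D, f⟩
        refine ⟨homogeneousProj 𝒢 p y, homogeneousProj_mem 𝒢 p y, ?_⟩
        rw [prolongationProj_apply, if_neg (by omega)]
        refine Prod.ext rfl (Prod.ext rfl (DFinsupp.ext fun k => ?_))
        rw [DFinsupp.filter_apply_neg _ (by omega)]
        rfl
      transitive := by
        intro p hp w hw hx
        by_cases hp0 : p = 0
        · subst hp0
          obtain ⟨D, rfl⟩ := hnonpos w hw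
          -- The kernel of a derivation is a subalgebra, so vanishing on the generators `𝒢 (-1)`
          -- suffices; the same works below for `u` of positive degree.
          have hD : ∀ x, (D : LieDerivation ℝ m m) x = 0 :=
            hgen { LinearMap.ker ((D : LieDerivation ℝ m m) : m →ₗ[ℝ] m) with
              lie_mem' := fun {x y} hx hy => by
                have hx : (D : LieDerivation ℝ m m) x = 0 := hx
                have hy : (D : LieDerivation ℝ m m) y = 0 := hy
                change (D : LieDerivation ℝ m m) ⁅x, y⁆ = 0
                rw [LieDerivation.apply_lie_eq_sub, hx, hy, lie_zero, lie_zero, sub_zero] }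
              fun x hx1 => by
                have := hx x hx1
                rw [hlie0] at this
                exact neg_eq_zero.1 (congrArg Prod.fst this)
          have : D = 0 := Subtype.ext (LieDerivation.ext hD)
          rw [this]
          rfl
        · obtain ⟨k, rfl⟩ : ∃ k : ℕ, p = (k : ℤ) + 1 := ⟨(p - 1).toNat, by omega⟩
          obtain ⟨u, rfl⟩ : ∃ u, w = ofPositive 𝒢 (g0 g) k u := by
            obtain ⟨y, D, f⟩ := w
            refine ⟨f k, ?_⟩
            rw [← hw, prolongationProj_apply, if_neg hp0]
            refine Prod.ext ?_ (Prod.ext rfl (DFinsupp.ext fun l => ?_))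
            · exact (Submodule.mem_bot ℝ).1
                ((h𝒢.eq_bot_of_nonneg _ hp).le (homogeneousProj_mem 𝒢 _ y))
            · change _ = (DFinsupp.single k (f k) : Π₀ k, positivePart 𝒢 (g0 g) k) l
              by_cases hl : k = l
              · subst hl
                change DFinsupp.filter (fun l : ℕ => (k : ℤ) + 1 = (l : ℤ) + 1) f k = _
                rw [DFinsupp.filter_apply, if_pos rfl, DFinsupp.single_eq_same]
              · rw [DFinsupp.single_eq_of_ne (Ne.symm hl)]
                exact (DFinsupp.filter_apply _ _ _).trans (if_neg (by omega))
          have hu : ∀ x, (u : m →ₗ[ℝ] (stage 𝒢 (g0 g) k).V) x = 0 :=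
            hgen { LinearMap.ker (u : m →ₗ[ℝ] (stage 𝒢 (g0 g) k).V) with
              lie_mem' := fun {x y} hx hy => by
                have hx : (u : m →ₗ[ℝ] (stage 𝒢 (g0 g) k).V) x = 0 := hx
                have hy : (u : m →ₗ[ℝ] (stage 𝒢 (g0 g) k).V) y = 0 := hy
                change (u : m →ₗ[ℝ] (stage 𝒢 (g0 g) k).V) ⁅x, y⁆ = 0
                rw [u.2.2, hx, hy, map_zero, LinearMap.zero_apply, LinearMap.zero_apply,
                  sub_zero] }
              fun x hx1 => by
                have := hx (-x) (neg_mem hx1)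
                rw [hlie, prolongationAct_ofPositive, neg_neg] at this
                exact (injective_iff_map_eq_zero _).1 (ofStage_injective k) _ this
          have : u = 0 := Subtype.ext (LinearMap.ext hu)
          rw [this, map_zero]
      acts_zero := fun w hw => by
        obtain ⟨D, rfl⟩ := hnonpos w hw
        exact ⟨-D, neg_mem D.2, fun x => hlie0 D x⟩ }
  exact hW.finiteDimensional hg

end SubRiem

/-- The prolongation of a conformal pseudo-subriemannian FGLA `(m, [g])` is finite dimensional,
both as constructed degree by degree, and in the form of any transitive graded Lie algebra with the
same components of degree `≤ 0` (the prolongation being the maximum of these). -/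
theorem lemma3p2 {m : Type u} [LieRing m] [LieAlgebra ℝ m] (𝒢 : ℤ → Submodule ℝ m)
    [GradedLieAlgebra 𝒢] (g : LinearMap.BilinForm ℝ (𝒢 (-1)))
    (hg : SubRiem.IsConformalPseudoSubriemannian 𝒢 g) :
    Module.Finite ℝ (SubRiem.Prolongation 𝒢 (SubRiem.g0 g)) ∧
    ∀ (L : Type v) [LieRing L] [LieAlgebra ℝ L] (ℒ : ℤ → Submodule ℝ L) [GradedLieAlgebra ℒ],
      SubRiem.IsTransitive ℒ →
      Nonempty (SubRiem.NonposIdentification 𝒢 (SubRiem.g0 g) ℒ) →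
      Module.Finite ℝ L :=
  ⟨SubRiem.finiteDimensional_prolongation hg, fun _ _ _ _ _ hℒ ⟨e⟩ =>
    SubRiem.finiteDimensional_of_isTransitive hg hℒ e⟩
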